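/- For a real Banach space $X$ with dual $X^*$, let $NA(X,\mathbb{R})$ be the set of norm-attaining functionals, i.e. of those $f\in X^*$ for which there is $x\in X$ with $\|x\|=1$ and $\|f\|=|f(x)|$. Call $X$ smooth if for every $x\in X$ with $\|x\|=1$ there is exactly one $f\in X^*$ with $\|f\|=1$ and $f(x)=1$. There is a smooth real Banach space $\mathbb{X}$ that is linearly homeomorphic to $c_0$ (that is, $\mathbb{X}$ is $c_0$ with an equivalent smooth norm), such that for every two-dimensional subspace $Z$ of $\mathbb{X}^*$ the intersection $Z\cap NA(\mathbb{X},\mathbb{R})$ is contained in the union of two one-dimensional subspaces; that is, the intersection of the unit sphere $S_Z$ of $Z$ with $NA(\mathbb{X},\mathbb{R})$ contains at most four points. Equivalently, if $f,g\in NA(\mathbb{X},\mathbb{R})$ are linearly independent, then no element $tf+(1-t)g$ with $0<t<1$ belongs to $NA(\mathbb{X},\mathbb{R})$. In particular, $NA(\mathbb{X},\mathbb{R})$ contains no non-trivial cone: no convex cone contained in $NA(\mathbb{X},\mathbb{R})$ has two linearly independent elements. These reformulations are equivalent in every real Banach space $E$: for each two-dimensional subspace $Z$ of $E^*$, the set $Z\cap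 NA(E,\mathbb{R})$ is contained in the union of two one-dimensional subspaces if and only if $S_Z\cap NA(E,\mathbb{R})$ has at most four points; and this holds for all such $Z$ if and only if no element of the interior of a segment between two linearly independent elements of $NA(E,\mathbb{R})$ belongs to $NA(E,\mathbb{R})$. -/

import Mathlib

open scoped ZeroAtInfty

/-- The set `NA(X, ℝ)` of norm-attaining functionals: the bounded linear functionals `f` on `X`
with `‖f‖ = |f x|` for some `x` in the unit sphere of `X`. -/
def normAttaining (X : Type*) [NormedAddCommGroup X] [NormedSpace ℝ X] :
    Set (StrongDual ℝ X) :=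
  {f | ∃ x : X, ‖x‖ = 1 ∧ ‖f‖ = |f x|}

/-- A normed space is smooth if every point of its unit sphere has exactly one norm-one
supporting functional. -/
def IsSmoothSpace (X : Type*) [NormedAddCommGroup X] [NormedSpace ℝ X] : Prop :=
  ∀ x : X, ‖x‖ = 1 → ∃! f : StrongDual ℝ X, ‖f‖ = 1 ∧ f x = 1

/-- The set `S` is contained in the union of two one-dimensional linear subspaces. -/
def SubsetTwoLines {V : Type*} [AddCommGroup V] [Module ℝ V] (S : Set V) : Prop :=
  ∃ L₁ L₂ : Submodule ℝ V, Module.finrank ℝ L₁ = 1 ∧ Module.finrank ℝ L₂ = 1 ∧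
    S ⊆ (L₁ : Set V) ∪ (L₂ : Set V)

/-- For every two-dimensional subspace `Z` of the dual of `X`, the norm-attaining functionals
in `Z` lie in the union of two lines. -/
def TwoLinesProperty (X : Type*) [NormedAddCommGroup X] [NormedSpace ℝ X] : Prop :=
  ∀ Z : Submodule ℝ (StrongDual ℝ X), Module.finrank ℝ Z = 2 →
    SubsetTwoLines ((Z : Set (StrongDual ℝ X)) ∩ normAttaining X)

/-- Given two linearly independent norm-attaining functionals, no point of the interior of the
segment between them is norm-attaining. -/
def SegmentProperty (X : Type*) [NormedAddCommGroup X] [NormedSpace ℝ X] : Prop :=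
  ∀ f ∈ normAttaining X, ∀ g ∈ normAttaining X, LinearIndependent ℝ ![f, g] →
    ∀ h ∈ openSegment ℝ f g, h ∉ normAttaining X

/-! ### The three reformulations in a general normed space -/

section TwoLines

/-! The new unit ball is `{modular ≤ 1}`, where `modular` is an even convex function on `c₀`: the
sum of `flatSq (x n)` plus a weighted sum of fourth powers of functionals `testFunctional i`. It has
a linear Gâteaux derivative `modularDeriv`, with a quadratic upper estimate along rays
(`exists_modular_add_smul_le`), so a functional attaining its norm at `x` must be a multiple of
`modularDeriv x` (`apply_eq_div_mul_modularDeriv`). This gives smoothness and describes all nonzero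
norm-attaining functionals.

If a point inside a segment between independent norm-attaining functionals is norm-attaining, then
`α D(x) + β D(y) = D(z)` with `α, β > 0`, where `D` is `modularDeriv`. Tested on unit vectors far
out, the `flatSq` terms vanish, because elements of `c₀` are eventually below `1` in absolute value.
The disjointly supported tails of the test functionals then separate the remaining series, giving `α
φ(x)³ + β φ(y)³ = φ(z)³` for each test functional `φ`
(`eq_zero_of_tsum_testFunctional_eventually_eq_zero`). The test functionals accumulate at every `eₘ
+ eₙ / 2`, which is enough to identify binary cubic forms. A sum of two cubes of independent linear
forms is not a cube (`cross_eq_of_cubes_add`), so `x` and `y` are proportional, hence `y = ±x`, and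
the two functionals are dependent. -/

theorem not_linearIndependent_of_mem_line {V : Type*} [AddCommGroup V] [Module ℝ V]
    {L : Submodule ℝ V} (hL : Module.finrank ℝ L = 1) {f g : V} (hf : f ∈ L) (hg : g ∈ L) :
    ¬ LinearIndependent ℝ ![f, g] := by
  intro h
  obtain ⟨v, -, hv⟩ := finrank_eq_one_iff'.1 hL
  obtain ⟨a, ha⟩ := hv ⟨f, hf⟩
  obtain ⟨b, hb⟩ := hv ⟨g, hg⟩
  have ha' : a • (v : V) = f := congrArg Subtype.val ha
  have hb' : b • (v : V) = g := congrArg Subtype.val hb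
  rw [LinearIndependent.pair_iff] at h
  have h1 := h b (-a) (by rw [← ha', ← hb', smul_smul, smul_smul, ← add_smul]; ring_nf; simp)
  have h2 := h 1 0 (by rw [← ha', neg_eq_zero.1 h1.2]; simp)
  exact one_ne_zero h2.1

theorem encard_pair_le_two {α : Type*} (a b : α) : ({a, b} : Set α).encard ≤ 2 := by
  refine (Set.encard_insert_le {b} a).trans ?_
  rw [Set.encard_singleton]; norm_num

theorem encard_line_inter_sphere_le {V : Type*} [NormedAddCommGroup V] [NormedSpace ℝ V]
    {L : Submodule ℝ V} (hL : Module.finrank ℝ L = 1) :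
    ((L : Set V) ∩ Metric.sphere 0 1).encard ≤ 2 := by
  obtain ⟨v, hv0, hv⟩ := finrank_eq_one_iff'.1 hL
  have hn : ‖(v : V)‖ ≠ 0 := by simpa using hv0
  refine le_trans (Set.encard_le_encard (t := {‖(v : V)‖⁻¹ • (v : V), -(‖(v : V)‖⁻¹ • (v : V))})
    ?_) (encard_pair_le_two _ _)
  rintro x ⟨hx, hx1⟩
  obtain ⟨c, hc⟩ := hv ⟨x, hx⟩
  have hc' : c • (v : V) = x := congrArg Subtype.val hc
  have h1 : |c| * ‖(v : V)‖ = 1 := by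
    rw [← Real.norm_eq_abs, ← norm_smul, hc']; simpa using hx1
  have h2 : |c| = ‖(v : V)‖⁻¹ := eq_inv_of_mul_eq_one_left h1
  rcases abs_choice c with h | h
  · left; rw [← hc', ← h2, h]
  · right; rw [Set.mem_singleton_iff, ← hc', ← h2, h]; simp

theorem subsetTwoLines_of_forall {V : Type*} [AddCommGroup V] [Module ℝ V] {S : Set V} {v w : V}
    (hv : v ≠ 0) (hw : w ≠ 0) (h : ∀ x ∈ S, (∃ c : ℝ, c • v = x) ∨ ∃ c : ℝ, c • w = x) :
    SubsetTwoLines S :=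
  ⟨Submodule.span ℝ {v}, Submodule.span ℝ {w}, finrank_span_singleton hv,
    finrank_span_singleton hw, fun x hx => (h x hx).imp
      (fun hc => Submodule.mem_span_singleton.2 hc) fun hc => Submodule.mem_span_singleton.2 hc⟩

theorem span_range_pair_eq {V : Type*} [AddCommGroup V] [Module ℝ V] {Z : Submodule ℝ V}
    (hZ : Module.finrank ℝ Z = 2) {f g : V} (hf : f ∈ Z) (hg : g ∈ Z)
    (hfg : LinearIndependent ℝ ![f, g]) : Submodule.span ℝ (Set.range ![f, g]) = Z := by
  have hZf : Module.Finite ℝ Z := Module.finite_of_finrank_pos (by omega)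
  refine Submodule.eq_of_le_of_finrank_eq (Submodule.span_le.2 ?_) ?_
  · rintro _ ⟨i, rfl⟩
    fin_cases i
    exacts [hf, hg]
  · rw [finrank_span_eq_card hfg, hZ]; simp

variable {E : Type*} [NormedAddCommGroup E] [NormedSpace ℝ E]

theorem smul_mem_normAttaining {f : StrongDual ℝ E} (hf : f ∈ normAttaining E) (c : ℝ) :
    c • f ∈ normAttaining E := by
  obtain ⟨x, hx, h⟩ := hf
  exact ⟨x, hx, by simp [norm_smul, h, abs_mul]⟩

theorem exists_ne_zero_of_finrank_eq_two {V : Type*} [AddCommGroup V] [Module ℝ V]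
    {Z : Submodule ℝ V} (hZ : Module.finrank ℝ Z = 2) : ∃ z : V, z ≠ 0 := by
  by_contra! h
  have : Z = ⊥ := by
    rw [Submodule.eq_bot_iff]; exact fun x _ => h x
  rw [this] at hZ
  simp at hZ

/-- The normalized norm-attaining functionals come in antipodal pairs, one pair for each line. Two
pairs and any further point would make five points. -/
theorem subsetTwoLines_iff_encard_le {Z : Submodule ℝ (StrongDual ℝ E)}
    (hZ : Module.finrank ℝ Z = 2) :
    SubsetTwoLines ((Z : Set (StrongDual ℝ E)) ∩ normAttaining E) ↔
      ((Z : Set (StrongDual ℝ E)) ∩ Metric.sphere 0 1 ∩ normAttaining E).encard ≤ 4 := by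
  constructor
  · rintro ⟨L₁, L₂, h₁, h₂, h⟩
    calc _ ≤ (((L₁ : Set (StrongDual ℝ E)) ∩ Metric.sphere 0 1) ∪
          ((L₂ : Set (StrongDual ℝ E)) ∩ Metric.sphere 0 1)).encard := by
            refine Set.encard_le_encard ?_
            rintro x ⟨⟨hx, hs⟩, hn⟩
            exact (h ⟨hx, hn⟩).imp (fun h => ⟨h, hs⟩) fun h => ⟨h, hs⟩
      _ ≤ 2 + 2 := (Set.encard_union_le _ _).trans
          (add_le_add (encard_line_inter_sphere_le h₁) (encard_line_inter_sphere_le h₂))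
      _ = 4 := by norm_num
  · intro h
    set T := (Z : Set (StrongDual ℝ E)) ∩ Metric.sphere 0 1 ∩ normAttaining E with hT
    have hneg : ∀ x ∈ T, -x ∈ T := fun x ⟨⟨h1, h2⟩, h3⟩ =>
      ⟨⟨Z.neg_mem h1, by simpa using h2⟩, by
        obtain ⟨y, hy, hxy⟩ := h3
        exact ⟨y, hy, by simpa using hxy⟩⟩
    have hne : ∀ x ∈ T, x ≠ 0 := by
      rintro x ⟨⟨-, h2⟩, -⟩ rfl
      simp at h2
    have hne' : ∀ x ∈ T, x ≠ -x := fun x hx he => hne x hx <| by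
      have h2 : (2 : ℝ) • x = 0 := by rw [two_smul]; nth_rw 2 [he]; exact add_neg_cancel x
      exact (smul_eq_zero.1 h2).resolve_left two_ne_zero
    -- every element of the intersection is a multiple of a normalized one
    have hmul : ∀ x ∈ (Z : Set (StrongDual ℝ E)) ∩ normAttaining E,
        x = 0 ∨ ∃ y ∈ T, ‖x‖ • y = x := by
      rintro x ⟨hx, hn⟩
      by_cases h0 : x = 0
      · exact Or.inl h0
      · refine Or.inr ⟨‖x‖⁻¹ • x, ⟨⟨Z.smul_mem _ hx, ?_⟩, smul_mem_normAttaining hn _⟩, ?_⟩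
        · simp [norm_smul, h0]
        · rw [smul_smul, mul_inv_cancel₀ (norm_ne_zero_iff.2 h0), one_smul]
    have key : ∀ u v : StrongDual ℝ E, u ≠ 0 → v ≠ 0 →
        (∀ y ∈ T, (y = u ∨ y = -u) ∨ (y = v ∨ y = -v)) →
        SubsetTwoLines ((Z : Set (StrongDual ℝ E)) ∩ normAttaining E) := by
      intro u v hu hv huv
      refine subsetTwoLines_of_forall hu hv fun x hx => ?_
      rcases hmul x hx with rfl | ⟨y, hy, hyx⟩
      · exact Or.inl ⟨0, zero_smul _ _⟩
      · rw [← hyx]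
        rcases huv y hy with (rfl | rfl) | (rfl | rfl)
        · exact Or.inl ⟨_, rfl⟩
        · exact Or.inl ⟨-‖x‖, by simp⟩
        · exact Or.inr ⟨_, rfl⟩
        · exact Or.inr ⟨-‖x‖, by simp⟩
    by_cases h0 : ∃ u, u ∈ T
    · obtain ⟨u, hu⟩ := h0
      by_cases h1 : ∃ v ∈ T, v ≠ u ∧ v ≠ -u
      · obtain ⟨v, hv, hvu, hvu'⟩ := h1
        refine key u v (hne u hu) (hne v hv) fun y hy => ?_
        by_contra! hcon
        obtain ⟨⟨ha, hb⟩, hc, hd⟩ := hcon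
        have hsub : ({y, u, -u, v, -v} : Set (StrongDual ℝ E)) ⊆ T := by
          rintro z (rfl | rfl | rfl | rfl | rfl)
          exacts [hy, hu, hneg _ hu, hv, hneg _ hv]
        have huv' : u ≠ -v := fun he => hvu' (by rw [he, neg_neg])
        have huv'' : -u ≠ -v := fun he => hvu (neg_injective he).symm
        have hcard : ({y, u, -u, v, -v} : Set (StrongDual ℝ E)).encard = 5 := by
          rw [Set.encard_insert_of_notMem (by simp [ha, hb, hc, hd]),
            Set.encard_insert_of_notMem (by simp [hne' u hu, hvu.symm, huv']),
            Set.encard_insert_of_notMem (by simp [hvu'.symm, hvu.symm]),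
            Set.encard_pair (hne' v hv)]
          norm_num
        have := (Set.encard_le_encard hsub).trans h
        rw [hcard] at this
        exact absurd this (by decide)
      · push Not at h1
        exact key u u (hne u hu) (hne u hu) fun y hy => Or.inl (or_iff_not_imp_left.2 (h1 y hy))
    -- With no norm-attaining functional on the sphere of `Z`, any line serves; a nonzero vector is
    -- still needed to span one.
    · obtain ⟨z, hz⟩ := exists_ne_zero_of_finrank_eq_two hZ
      exact key z z hz hz fun y hy => absurd ⟨y, hy⟩ h0

/-- The two endpoints and an interior point are pairwise independent, so two lines cannot contain
all three. -/
theorem segmentProperty_of_twoLinesProperty (h : TwoLinesProperty E) : SegmentProperty E := by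
  rintro f hf g hg hfg _ ⟨a, b, ha, hb, -, rfl⟩ hh
  have hfin : Module.finrank ℝ (Submodule.span ℝ (Set.range ![f, g])) = 2 := by
    rw [finrank_span_eq_card hfg]; simp
  obtain ⟨L₁, L₂, h₁, h₂, hL⟩ := h _ hfin
  have hfm : f ∈ Submodule.span ℝ (Set.range ![f, g]) := Submodule.subset_span ⟨0, rfl⟩
  have hgm : g ∈ Submodule.span ℝ (Set.range ![f, g]) := Submodule.subset_span ⟨1, rfl⟩
  have hhm := Submodule.add_mem _ (Submodule.smul_mem _ a hfm) (Submodule.smul_mem _ b hgm)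
  have hpair := LinearIndependent.pair_iff.1 hfg
  have key : ∀ L : Submodule ℝ (StrongDual ℝ E), Module.finrank ℝ L = 1 →
      (f ∈ L → g ∈ L → False) ∧ (f ∈ L → a • f + b • g ∈ L → False) ∧
        (g ∈ L → a • f + b • g ∈ L → False) := by
    intro L h1
    have h0 : f ∈ L → g ∈ L → False := fun hf hg =>
      not_linearIndependent_of_mem_line h1 hf hg hfg
    refine ⟨h0, fun hf hh => h0 hf ?_, fun hg hh => h0 ?_ hg⟩
    · exact (L.smul_mem_iff hb.ne').1 ((L.add_mem_iff_right (L.smul_mem a hf)).1 hh)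
    · exact (L.smul_mem_iff ha.ne').1 ((L.add_mem_iff_left (L.smul_mem b hg)).1 hh)
  obtain ⟨k1, k2, k3⟩ := key L₁ h₁
  obtain ⟨l1, l2, l3⟩ := key L₂ h₂
  have m1 := hL ⟨hfm, hf⟩
  have m2 := hL ⟨hgm, hg⟩
  have m3 := hL ⟨hhm, hh⟩
  simp only [Set.mem_union, SetLike.mem_coe] at m1 m2 m3
  tauto

/-- Norm attainment is invariant under scaling. Hence, once independent `f` and `g` are fixed, a
combination with both coefficients nonzero rescales into the open segment between `±f` and `±g`. -/
theorem twoLinesProperty_of_segmentProperty (h : SegmentProperty E) : TwoLinesProperty E := by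
  intro Z hZ
  obtain ⟨z, hz⟩ := exists_ne_zero_of_finrank_eq_two hZ
  by_cases h0 : ∃ f ∈ (Z : Set (StrongDual ℝ E)) ∩ normAttaining E, f ≠ 0
  swap
  · push Not at h0
    exact subsetTwoLines_of_forall hz hz fun x hx => Or.inl ⟨0, by simp [h0 x hx]⟩
  obtain ⟨f, hf, hf0⟩ := h0
  by_cases h1 : ∃ g ∈ (Z : Set (StrongDual ℝ E)) ∩ normAttaining E, LinearIndependent ℝ ![f, g]
  swap
  · push Not at h1
    refine subsetTwoLines_of_forall hf0 hf0 fun x hx => Or.inl ?_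
    have := h1 x hx
    rw [LinearIndependent.pair_iff' hf0] at this
    push Not at this
    exact this
  obtain ⟨g, hg, hfg⟩ := h1
  have hg0 : g ≠ 0 := hfg.ne_zero 1
  refine subsetTwoLines_of_forall hf0 hg0 fun x hx => ?_
  have hxm : x ∈ Submodule.span ℝ (Set.range ![f, g]) := by
    rw [span_range_pair_eq hZ hf.1 hg.1 hfg]; exact hx.1
  rw [Matrix.range_cons_cons_empty, Submodule.mem_span_pair] at hxm
  obtain ⟨a, b, rfl⟩ := hxm
  by_cases ha : a = 0
  · exact Or.inr ⟨b, by simp [ha]⟩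
  by_cases hb : b = 0
  · exact Or.inl ⟨a, by simp [hb]⟩
  exfalso
  have hab : 0 < |a| + |b| := add_pos (abs_pos.2 ha) (abs_pos.2 hb)
  -- replacing `f` and `g` by `±f` and `±g`, the coefficients become positive
  have hli : LinearIndependent ℝ ![(a / |a|) • f, (b / |b|) • g] := by
    rw [LinearIndependent.pair_iff] at hfg ⊢
    intro s t hst
    rw [smul_smul, smul_smul] at hst
    have := hfg _ _ hst
    simpa [ha, hb] using this
  refine h _ (smul_mem_normAttaining hf.2 (a / |a|)) _ (smul_mem_normAttaining hg.2 (b / |b|)) hli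
    ((|a| + |b|)⁻¹ • (a • f + b • g)) ⟨|a| / (|a| + |b|), |b| / (|a| + |b|),
      div_pos (abs_pos.2 ha) hab, div_pos (abs_pos.2 hb) hab, ?_, ?_⟩
    (smul_mem_normAttaining hx.2 _)
  · rw [← add_div, div_self hab.ne']
  · have ha' := abs_pos.2 ha
    have hb' := abs_pos.2 hb
    rw [smul_add, smul_smul, smul_smul, smul_smul, smul_smul]
    congr 2 <;> field_simp

theorem not_linearIndependent_of_convexCone (h : SegmentProperty E)
    {C : ConvexCone ℝ (StrongDual ℝ E)} (hC : (C : Set (StrongDual ℝ E)) ⊆ normAttaining E)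
    {f g : StrongDual ℝ E} (hf : f ∈ C) (hg : g ∈ C) : ¬ LinearIndependent ℝ ![f, g] := by
  intro hfg
  have h2 : (0 : ℝ) < 1 / 2 := by norm_num
  exact h f (hC hf) g (hC hg) hfg _ ⟨1 / 2, 1 / 2, h2, h2, by norm_num, rfl⟩
    (hC (C.add_mem (C.smul_mem h2 hf) (C.smul_mem h2 hg)))

end TwoLines

/-! ### A scalar convex function that is flat near zero -/

section FlatSquare

/-- The `C¹` even convex function `t ↦ (|t| - 1)₊²`, which vanishes on `[-1, 1]`. -/
noncomputable def flatSq (t : ℝ) : ℝ := max (t - 1) 0 ^ 2 + max (-t - 1) 0 ^ 2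

/-- The derivative of `flatSq`. -/
noncomputable def flatSqDeriv (t : ℝ) : ℝ := 2 * max (t - 1) 0 - 2 * max (-t - 1) 0

theorem flatSq_nonneg (t : ℝ) : 0 ≤ flatSq t := by unfold flatSq; positivity

theorem flatSq_neg (t : ℝ) : flatSq (-t) = flatSq t := by
  unfold flatSq; rw [neg_neg, add_comm]

theorem flatSqDeriv_neg (t : ℝ) : flatSqDeriv (-t) = -flatSqDeriv t := by
  unfold flatSqDeriv; rw [neg_neg]; ring

theorem flatSq_eq_zero {t : ℝ} (h : |t| ≤ 1) : flatSq t = 0 := by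
  have := abs_le.1 h
  unfold flatSq
  rw [max_eq_right (by linarith), max_eq_right (by linarith)]; norm_num

theorem flatSqDeriv_eq_zero {t : ℝ} (h : |t| ≤ 1) : flatSqDeriv t = 0 := by
  have := abs_le.1 h
  unfold flatSqDeriv
  rw [max_eq_right (by linarith), max_eq_right (by linarith)]; norm_num

theorem abs_le_two_of_flatSq_le_one {t : ℝ} (h : flatSq t ≤ 1) : |t| ≤ 2 := by
  unfold flatSq at h
  rw [abs_le]
  constructor
  · by_contra! hc
    have h1 : 1 < max (-t - 1) 0 := lt_max_of_lt_left (by linarith)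
    nlinarith [sq_nonneg (max (t - 1) 0)]
  · by_contra! hc
    have h1 : 1 < max (t - 1) 0 := lt_max_of_lt_left (by linarith)
    nlinarith [sq_nonneg (max (-t - 1) 0)]

theorem flatSq_le_flatSqDeriv_mul (t : ℝ) : flatSq t ≤ flatSqDeriv t * t := by
  unfold flatSq flatSqDeriv
  rcases le_total (t - 1) 0 with h1 | h1 <;> rcases le_total (-t - 1) 0 with h2 | h2 <;>
    simp only [h1, h2, max_eq_left, max_eq_right] <;> nlinarith

/-- The derivative `2 s₊` of `s₊²` is 2-Lipschitz, which gives the remainder `h²`. -/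
theorem max_zero_sq_add_le (s h : ℝ) :
    max (s + h) 0 ^ 2 ≤ max s 0 ^ 2 + 2 * max s 0 * h + h ^ 2 := by
  rcases le_total s 0 with h1 | h1 <;> rcases le_total (s + h) 0 with h2 | h2 <;>
    simp only [h1, h2, max_eq_left, max_eq_right] <;> nlinarith

theorem flatSq_add_le (t h : ℝ) : flatSq (t + h) ≤ flatSq t + flatSqDeriv t * h + 2 * h ^ 2 := by
  have h1 := max_zero_sq_add_le (t - 1) h
  have h2 := max_zero_sq_add_le (-t - 1) (-h)
  unfold flatSq flatSqDeriv
  rw [show t + h - 1 = t - 1 + h by ring, show -(t + h) - 1 = -t - 1 + -h by ring]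
  nlinarith

theorem convexOn_flatSq : ConvexOn ℝ Set.univ flatSq := by
  have h1 : ConvexOn ℝ Set.univ fun t : ℝ => max (t - 1) 0 :=
    ((convexOn_id convex_univ).sub (concaveOn_const 1 convex_univ)).sup
      (convexOn_const 0 convex_univ)
  have h2 : ConvexOn ℝ Set.univ fun t : ℝ => max (-t - 1) 0 :=
    (((concaveOn_id convex_univ).neg).sub (concaveOn_const 1 convex_univ)).sup
      (convexOn_const 0 convex_univ)
  exact (h1.pow (fun _ _ => le_max_right _ _) 2).add (h2.pow (fun _ _ => le_max_right _ _) 2)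

end FlatSquare

/-! ### Test functionals on `c₀` -/

section Functionals

theorem ZeroAtInftyContinuousMap.abs_apply_le_norm (x : C₀(ℕ, ℝ)) (n : ℕ) : |x n| ≤ ‖x‖ := by
  rw [← ZeroAtInftyContinuousMap.norm_toBCF_eq_norm]
  exact x.toBCF.norm_coe_le_norm n

theorem ZeroAtInftyContinuousMap.norm_le_of_forall_abs_le {x : C₀(ℕ, ℝ)} {C : ℝ}
    (h : ∀ n, |x n| ≤ C) : ‖x‖ ≤ C := by
  rw [← ZeroAtInftyContinuousMap.norm_toBCF_eq_norm]
  exact (BoundedContinuousFunction.norm_le ((abs_nonneg _).trans (h 0))).2 h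

theorem ZeroAtInftyContinuousMap.eventually_abs_lt (x : C₀(ℕ, ℝ)) {ε : ℝ} (hε : 0 < ε) :
    ∀ᶠ n in Filter.atTop, |x n| < ε := by
  have h := x.zero_at_infty'
  rw [Filter.cocompact_eq_cofinite, Nat.cofinite_eq_atTop] at h
  have := (h.abs).eventually (gt_mem_nhds (by simpa using hε))
  exact this

/-- The unit vectors of `c₀`. -/
noncomputable def unitVec (n : ℕ) : C₀(ℕ, ℝ) where
  toFun := Pi.single n 1
  continuous_toFun := continuous_of_discreteTopology
  zero_at_infty' := by
    rw [Filter.cocompact_eq_cofinite, Nat.cofinite_eq_atTop]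
    refine tendsto_const_nhds.congr' ?_
    filter_upwards [Filter.eventually_gt_atTop n] with m hm
    simp [hm.ne']

theorem unitVec_apply (n m : ℕ) : unitVec n m = if m = n then 1 else 0 := by
  change (Pi.single n 1 : ℕ → ℝ) m = _
  rw [Pi.single_apply]

/-- The coefficients of a small element of `ℓ₁` supported by the `i`-th block of an infinite
partition of `ℕ` into infinite sets. -/
noncomputable def tailCoeff (i n : ℕ) : ℝ := if n.unpair.1 = i then (1 / 4) ^ n else 0

/-- Block `i` contains only indices `n ≥ i`, so half of the decay of `4⁻ⁿ` can be traded for decay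
in `i`. This makes the tails vanish in the limit. -/
theorem abs_tailCoeff_le (i n : ℕ) : |tailCoeff i n| ≤ (1 / 2) ^ i * (1 / 2) ^ n := by
  unfold tailCoeff
  split_ifs with h
  · rw [abs_of_nonneg (by positivity), show (1 / 4 : ℝ) = 1 / 2 * (1 / 2) by norm_num, mul_pow]
    have : i ≤ n := h ▸ Nat.unpair_left_le n
    gcongr ?_ * _
    exact pow_le_pow_of_le_one (by norm_num) (by norm_num) this
  · rw [abs_zero]; positivity

theorem abs_tailCoeff_mul_le (i : ℕ) (x : C₀(ℕ, ℝ)) (n : ℕ) :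
    ‖tailCoeff i n * x n‖ ≤ (1 / 2) ^ i * ‖x‖ * (1 / 2) ^ n := by
  rw [Real.norm_eq_abs, abs_mul]
  calc _ ≤ ((1 / 2) ^ i * (1 / 2) ^ n) * ‖x‖ := by
        gcongr
        exacts [abs_tailCoeff_le i n, x.abs_apply_le_norm n]
    _ = _ := by ring

theorem summable_tailCoeff_mul (i : ℕ) (x : C₀(ℕ, ℝ)) :
    Summable fun n => tailCoeff i n * x n :=
  (summable_geometric_two.mul_left _).of_norm_bounded (abs_tailCoeff_mul_le i x)

/-- The functional with coefficients `tailCoeff i`. -/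
noncomputable def tailFunctional (i : ℕ) : C₀(ℕ, ℝ) →ₗ[ℝ] ℝ where
  toFun x := ∑' n, tailCoeff i n * x n
  map_add' x y := by
    rw [← (summable_tailCoeff_mul i x).tsum_add (summable_tailCoeff_mul i y)]
    simp [mul_add]
  map_smul' c x := by
    rw [RingHom.id_apply, smul_eq_mul, ← tsum_mul_left]
    refine tsum_congr fun n => ?_
    simp only [ZeroAtInftyContinuousMap.smul_apply, smul_eq_mul]; ring

theorem abs_tailFunctional_le (i : ℕ) (x : C₀(ℕ, ℝ)) :
    |tailFunctional i x| ≤ (1 / 2) ^ i * ‖x‖ * 2 := by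
  have h := tsum_of_norm_bounded (hasSum_geometric_two.mul_left ((1 / 2) ^ i * ‖x‖))
    (abs_tailCoeff_mul_le i x)
  exact h

theorem tailFunctional_unitVec (i n : ℕ) : tailFunctional i (unitVec n) = tailCoeff i n := by
  change ∑' m, tailCoeff i m * unitVec n m = _
  rw [tsum_eq_single n fun m hm => by simp [unitVec_apply, hm]]
  simp [unitVec_apply]

/-- Functionals on `c₀` that accumulate at all `eₘ + eₙ / 2`, and whose bounded combinations
with geometric weights are never finitely supported. -/
noncomputable def testFunctional (i : ℕ) : C₀(ℕ, ℝ) →ₗ[ℝ] ℝ where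
  toFun x := x i.unpair.1.unpair.1 + 1 / 2 * x i.unpair.1.unpair.2 + tailFunctional i x
  map_add' x y := by simp only [ZeroAtInftyContinuousMap.add_apply, map_add]; ring
  map_smul' c x := by
    simp only [ZeroAtInftyContinuousMap.smul_apply, map_smul, smul_eq_mul, RingHom.id_apply]; ring

theorem testFunctional_apply (i : ℕ) (x : C₀(ℕ, ℝ)) : testFunctional i x =
    x i.unpair.1.unpair.1 + 1 / 2 * x i.unpair.1.unpair.2 + tailFunctional i x := rfl

theorem abs_testFunctional_le (i : ℕ) (x : C₀(ℕ, ℝ)) : |testFunctional i x| ≤ 4 * ‖x‖ := by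
  have h1 := x.abs_apply_le_norm i.unpair.1.unpair.1
  have h2 := x.abs_apply_le_norm i.unpair.1.unpair.2
  have h3 := abs_tailFunctional_le i x
  have h4 : (1 / 2 : ℝ) ^ i ≤ 1 := pow_le_one₀ (by norm_num) (by norm_num)
  have h5 : (1 / 2 : ℝ) ^ i * ‖x‖ ≤ 1 * ‖x‖ := by gcongr
  rw [testFunctional_apply]
  rw [abs_le] at h1 h2 h3 ⊢
  constructor <;> linarith [norm_nonneg x, h1.1, h1.2, h2.1, h2.2, h3.1, h3.2]

theorem tendsto_testFunctional (m n : ℕ) (x : C₀(ℕ, ℝ)) :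
    Filter.Tendsto (fun k => testFunctional (Nat.pair (Nat.pair m n) k) x) Filter.atTop
      (nhds (x m + 1 / 2 * x n)) := by
  have ht : Filter.Tendsto (fun k => tailFunctional (Nat.pair (Nat.pair m n) k) x) Filter.atTop
      (nhds 0) := by
    have h0 : Filter.Tendsto (fun k : ℕ => (1 / 2 : ℝ) ^ k * ‖x‖ * 2) Filter.atTop (nhds 0) := by
      simpa using ((tendsto_pow_atTop_nhds_zero_of_lt_one (r := (1 / 2 : ℝ)) (by norm_num)
        (by norm_num)).mul_const ‖x‖).mul_const 2
    refine squeeze_zero_norm (fun k => ?_) h0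
    refine (abs_tailFunctional_le _ x).trans ?_
    gcongr ?_ * _ * _
    exact pow_le_pow_of_le_one (by norm_num) (by norm_num) (Nat.right_le_pair _ _)
  simpa [testFunctional_apply] using ht.const_add (x m + 1 / 2 * x n)

/-- Evaluate at `eₙ` with `n` in block `j`. Among the tails only the `j`-th contributes, with size
`16⁻ʲ |c j| 4⁻ⁿ`; the coordinate parts with `i < n` do not see `eₙ`, and the others total at most
`4M · 8⁻ⁿ`. Since `8⁻ⁿ` is negligible against `4⁻ⁿ`, letting `n` run through the block gives `c j =
0`. -/
theorem eq_zero_of_tsum_testFunctional_eventually_eq_zero {c : ℕ → ℝ} {M : ℝ}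
    (hc : ∀ i, |c i| ≤ M)
    (h : ∀ᶠ n in Filter.atTop, ∑' i, (1 / 16) ^ i * (c i * testFunctional i (unitVec n)) = 0)
    (j : ℕ) : c j = 0 := by
  have hM : 0 ≤ M := (abs_nonneg _).trans (hc 0)
  have hbound : ∀ᶠ k in Filter.atTop,
      ‖c j * (1 / 16) ^ j‖ ≤ 4 * M * (1 / 2) ^ k := by
    have hp : Filter.Tendsto (fun k => Nat.pair j k) Filter.atTop Filter.atTop :=
      Filter.tendsto_atTop_mono (fun k => Nat.right_le_pair j k) Filter.tendsto_id
    filter_upwards [hp.eventually h] with k hk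
    set n := Nat.pair j k with hn
    set q : ℕ → ℝ := fun i => unitVec n i.unpair.1.unpair.1 + 1 / 2 * unitVec n i.unpair.1.unpair.2
      with hq
    have hq2 : ∀ i, |q i| ≤ 2 := by
      intro i
      simp only [hq, unitVec_apply]
      split_ifs <;> norm_num [abs_le]
    have hq0 : ∀ i, i < n → q i = 0 := by
      intro i hi
      have h1 := Nat.unpair_left_le i
      have h2 := Nat.unpair_left_le i.unpair.1
      have h3 := Nat.unpair_right_le i.unpair.1
      simp only [hq, unitVec_apply]
      rw [if_neg (by omega), if_neg (by omega)]
      norm_num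
    have hqb : ∀ i, ‖(1 / 16) ^ i * (c i * q i)‖ ≤ 2 * M * (1 / 8) ^ n * (1 / 2) ^ i := by
      intro i
      rcases lt_or_ge i n with hi | hi
      · rw [hq0 i hi]; simp; positivity
      -- The weight `16⁻ⁱ` is split as `8⁻ⁱ 2⁻ⁱ`: the first factor is at most `8⁻ⁿ`, the second
      -- keeps the series summable.
      · rw [Real.norm_eq_abs, abs_mul, abs_mul, abs_of_nonneg (by positivity),
          show (1 / 16 : ℝ) = 1 / 8 * (1 / 2) by norm_num, mul_pow]
        calc (1 / 8 : ℝ) ^ i * (1 / 2) ^ i * (|c i| * |q i|)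
            ≤ (1 / 8) ^ n * (1 / 2) ^ i * (M * 2) := by
              gcongr ?_ * _ * (?_ * ?_)
              exacts [pow_le_pow_of_le_one (by norm_num) (by norm_num) hi, hc i, hq2 i]
          _ = _ := by ring
    have hs := (summable_geometric_two.mul_left (2 * M * (1 / 8) ^ n)).of_norm_bounded hqb
    have hle : |∑' i, (1 / 16) ^ i * (c i * q i)| ≤ 2 * M * (1 / 8) ^ n * 2 :=
      tsum_of_norm_bounded (hasSum_geometric_two.mul_left _) hqb
    have ht : HasSum (fun i => (1 / 16) ^ i * (c i * tailCoeff i n))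
        ((1 / 16) ^ j * (c j * (1 / 4) ^ n)) := by
      convert hasSum_single (f := fun i => (1 / 16) ^ i * (c i * tailCoeff i n)) j ?_ using 3
      · simp [tailCoeff, hn]
      · intro i hi
        simp [tailCoeff, hn, hi.symm]
    have hsum : ∑' i, (1 / 16) ^ i * (c i * testFunctional i (unitVec n)) =
        ∑' i, (1 / 16) ^ i * (c i * q i) + (1 / 16) ^ j * (c j * (1 / 4) ^ n) := by
      rw [← ht.tsum_eq, ← hs.tsum_add ht.summable]
      refine tsum_congr fun i => ?_
      rw [testFunctional_apply, tailFunctional_unitVec]; simp only [hq]; ring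
    rw [hsum] at hk
    have h1 : |(1 / 16) ^ j * (c j * (1 / 4) ^ n)| ≤ 2 * M * (1 / 8) ^ n * 2 := by
      rw [← neg_eq_of_add_eq_zero_right hk, abs_neg]; exact hle
    have h2 : (1 / 8 : ℝ) ^ n = (1 / 2) ^ n * (1 / 4) ^ n := by rw [← mul_pow]; norm_num
    have h3 : |c j * (1 / 16) ^ j| * (1 / 4) ^ n ≤ 4 * M * (1 / 2) ^ n * (1 / 4) ^ n := by
      calc _ = |(1 / 16) ^ j * (c j * (1 / 4) ^ n)| := by
            simp only [abs_mul, abs_of_nonneg (show (0 : ℝ) ≤ (1 / 4) ^ n by positivity)]; ring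
        _ ≤ _ := h1
        _ = _ := by rw [h2]; ring
    refine (le_of_mul_le_mul_right h3 (by positivity)).trans ?_
    gcongr _ * ?_
    exact pow_le_pow_of_le_one (by norm_num) (by norm_num) (Nat.right_le_pair j k)
  have hlim : Filter.Tendsto (fun k : ℕ => 4 * M * (1 / 2 : ℝ) ^ k) Filter.atTop (nhds 0) := by
    simpa using (tendsto_pow_atTop_nhds_zero_of_lt_one (r := (1 / 2 : ℝ)) (by norm_num)
      (by norm_num)).const_mul (4 * M)
  have := norm_le_zero_iff.1 (ge_of_tendsto hlim hbound)
  simpa using this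

end Functionals

/-! ### The modular and its Gâteaux derivative -/

section Gauge

theorem summable_of_eventually_atTop_eq_zero {f : ℕ → ℝ}
    (h : ∀ᶠ n in Filter.atTop, f n = 0) : Summable f := by
  obtain ⟨N, hN⟩ := Filter.eventually_atTop.1 h
  exact summable_of_ne_finset_zero (s := Finset.range N) fun n hn => hN n (by simpa using hn)

theorem summable_geometric_mul_of_abs_le {c : ℕ → ℝ} {M : ℝ} (hc : ∀ i, |c i| ≤ M) :
    Summable fun i => (1 / 16) ^ i * c i := by
  refine ((summable_geometric_of_lt_one (r := (1 / 16 : ℝ)) (by norm_num)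
    (by norm_num)).mul_right M).of_norm_bounded fun i => ?_
  rw [Real.norm_eq_abs, abs_mul, abs_of_nonneg (by positivity)]
  gcongr
  exact hc i

/-- The convex function whose sublevel set `{N ≤ 1}` is the unit ball of the new norm. -/
noncomputable def modular (x : C₀(ℕ, ℝ)) : ℝ :=
  ∑' n, flatSq (x n) + ∑' i, (1 / 16) ^ i * testFunctional i x ^ 4

theorem eventually_flatSq_eq_zero (x : C₀(ℕ, ℝ)) : ∀ᶠ n in Filter.atTop, flatSq (x n) = 0 :=
  (x.eventually_abs_lt one_pos).mono fun _ h => flatSq_eq_zero h.le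

theorem eventually_flatSqDeriv_eq_zero (x : C₀(ℕ, ℝ)) :
    ∀ᶠ n in Filter.atTop, flatSqDeriv (x n) = 0 :=
  (x.eventually_abs_lt one_pos).mono fun _ h => flatSqDeriv_eq_zero h.le

theorem summable_flatSq (x : C₀(ℕ, ℝ)) : Summable fun n => flatSq (x n) :=
  summable_of_eventually_atTop_eq_zero (eventually_flatSq_eq_zero x)

theorem summable_flatSqDeriv_mul (x h : C₀(ℕ, ℝ)) : Summable fun n => flatSqDeriv (x n) * h n :=
  summable_of_eventually_atTop_eq_zero
    ((eventually_flatSqDeriv_eq_zero x).mono fun _ h => by rw [h, zero_mul])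

theorem abs_testFunctional_pow_le (i k : ℕ) (x : C₀(ℕ, ℝ)) :
    |testFunctional i x ^ k| ≤ (4 * ‖x‖) ^ k := by
  rw [abs_pow]
  exact pow_le_pow_left₀ (abs_nonneg _) (abs_testFunctional_le i x) k

theorem summable_testFunctional_pow_four (x : C₀(ℕ, ℝ)) :
    Summable fun i => (1 / 16) ^ i * testFunctional i x ^ 4 :=
  summable_geometric_mul_of_abs_le fun i => abs_testFunctional_pow_le i 4 x

theorem summable_testFunctional_pow_three_mul (x h : C₀(ℕ, ℝ)) :
    Summable fun i => (1 / 16) ^ i * (testFunctional i x ^ 3 * testFunctional i h) :=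
  summable_geometric_mul_of_abs_le (M := (4 * ‖x‖) ^ 3 * (4 * ‖h‖)) fun i => by
    rw [abs_mul]
    exact mul_le_mul (abs_testFunctional_pow_le i 3 x) (abs_testFunctional_le i h)
      (abs_nonneg _) (by positivity)

/-- The Gâteaux derivative of `modular` at `x`. -/
noncomputable def modularDeriv (x : C₀(ℕ, ℝ)) : C₀(ℕ, ℝ) →ₗ[ℝ] ℝ where
  toFun h := ∑' n, flatSqDeriv (x n) * h n +
    4 * ∑' i, (1 / 16) ^ i * (testFunctional i x ^ 3 * testFunctional i h)
  map_add' h k := by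
    simp only [map_add, ZeroAtInftyContinuousMap.add_apply, mul_add]
    rw [(summable_flatSqDeriv_mul x h).tsum_add (summable_flatSqDeriv_mul x k),
      (summable_testFunctional_pow_three_mul x h).tsum_add
        (summable_testFunctional_pow_three_mul x k)]
    ring
  map_smul' c h := by
    simp only [map_smul, ZeroAtInftyContinuousMap.smul_apply, smul_eq_mul, RingHom.id_apply,
      mul_left_comm _ c, tsum_mul_left]
    ring

theorem modularDeriv_apply (x h : C₀(ℕ, ℝ)) : modularDeriv x h =
    ∑' n, flatSqDeriv (x n) * h n +
      4 * ∑' i, (1 / 16) ^ i * (testFunctional i x ^ 3 * testFunctional i h) := rfl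

theorem modular_neg (x : C₀(ℕ, ℝ)) : modular (-x) = modular x := by
  simp [modular, flatSq_neg, Even.neg_pow (by decide : Even 4)]

theorem modularDeriv_neg (x : C₀(ℕ, ℝ)) : modularDeriv (-x) = -modularDeriv x := by
  ext h
  simp [modularDeriv_apply, flatSqDeriv_neg, Odd.neg_pow (by decide : Odd 3), tsum_neg]
  ring

/-- This makes the derivative at a unit vector strictly positive in the radial direction. -/
theorem modular_le_modularDeriv_self (x : C₀(ℕ, ℝ)) : modular x ≤ modularDeriv x x := by
  rw [modular, modularDeriv_apply]
  have h1 := (summable_flatSq x).tsum_le_tsum (fun n => flatSq_le_flatSqDeriv_mul (x n))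
    (summable_flatSqDeriv_mul x x)
  have h2 : 0 ≤ ∑' i, (1 / 16 : ℝ) ^ i * testFunctional i x ^ 4 :=
    tsum_nonneg fun i => by positivity
  simp only [← pow_succ]
  linarith

theorem convexOn_modular : ConvexOn ℝ Set.univ modular := by
  refine ⟨convex_univ, fun x _ y _ a b ha hb hab => ?_⟩
  have h1 := (summable_flatSq (a • x + b • y)).tsum_le_tsum
    (fun n => convexOn_flatSq.2 (Set.mem_univ (x n)) (Set.mem_univ (y n)) ha hb hab)
    (((summable_flatSq x).const_smul a).add ((summable_flatSq y).const_smul b))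
  have hpow : ConvexOn ℝ Set.univ fun t : ℝ => t ^ 4 := Even.convexOn_pow (by decide)
  have h2 := (summable_testFunctional_pow_four (a • x + b • y)).tsum_le_tsum (g := fun i =>
      a * ((1 / 16) ^ i * testFunctional i x ^ 4) + b * ((1 / 16) ^ i * testFunctional i y ^ 4))
    (fun i => by
      have := hpow.2 (Set.mem_univ (testFunctional i x)) (Set.mem_univ (testFunctional i y))
        ha hb hab
      simp only [smul_eq_mul] at this
      rw [map_add, map_smul, map_smul, smul_eq_mul, smul_eq_mul]
      have h3 := mul_le_mul_of_nonneg_left this (show (0 : ℝ) ≤ (1 / 16) ^ i by positivity)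
      linarith)
    (((summable_testFunctional_pow_four x).mul_left a).add
      ((summable_testFunctional_pow_four y).mul_left b))
  rw [Summable.tsum_add ((summable_flatSq x).const_smul a) ((summable_flatSq y).const_smul b)] at h1
  rw [Summable.tsum_add ((summable_testFunctional_pow_four x).mul_left a)
    ((summable_testFunctional_pow_four y).mul_left b)] at h2
  simp only [smul_eq_mul, tsum_mul_left] at h1 h2 ⊢
  unfold modular
  simp only [ZeroAtInftyContinuousMap.add_apply, ZeroAtInftyContinuousMap.smul_apply, smul_eq_mul]
  linarith

/-- Binomial expansion, with the cubic and quartic terms in `t` absorbed into `t²` since `t ≤ 1`.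
The remainder depends only on `A` and `B`, hence is uniform over the test functionals. -/
theorem add_mul_pow_four_le {a b A B t : ℝ} (ha : |a| ≤ A) (hb : |b| ≤ B) (ht : 0 ≤ t)
    (ht1 : t ≤ 1) : (a + t * b) ^ 4 ≤
      a ^ 4 + t * (4 * (a ^ 3 * b)) + t ^ 2 * (6 * A ^ 2 * B ^ 2 + 4 * A * B ^ 3 + B ^ 4) := by
  have h1 : a ^ 2 * b ^ 2 ≤ A ^ 2 * B ^ 2 := by
    rw [← sq_abs a, ← sq_abs b]; gcongr
  have h2 : b ^ 4 ≤ B ^ 4 := by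
    rw [← Even.pow_abs (by decide : Even 4) b]; gcongr
  have h3 : a * b ^ 3 ≤ A * B ^ 3 := by
    refine (le_abs_self _).trans ?_
    rw [abs_mul, abs_pow]; gcongr
    exact (abs_nonneg _).trans ha
  have hA := (abs_nonneg _).trans ha
  have hB := (abs_nonneg _).trans hb
  have h4 : t * (a * b ^ 3) ≤ A * B ^ 3 :=
    (mul_le_mul_of_nonneg_left h3 ht).trans (mul_le_of_le_one_left (by positivity) ht1)
  have h5 : t ^ 2 * b ^ 4 ≤ B ^ 4 := (mul_le_of_le_one_left (by positivity)
    (pow_le_one₀ ht ht1)).trans h2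
  have h6 : t ^ 2 * (6 * (a ^ 2 * b ^ 2) + 4 * (t * (a * b ^ 3)) + t ^ 2 * b ^ 4) ≤
      t ^ 2 * (6 * A ^ 2 * B ^ 2 + 4 * A * B ^ 3 + B ^ 4) :=
    mul_le_mul_of_nonneg_left (by linarith) (sq_nonneg t)
  nlinarith

/-- The second-order upper estimate of `modular` along a ray. -/
theorem exists_modular_add_smul_le (x h : C₀(ℕ, ℝ)) : ∃ C, 0 ≤ C ∧ ∀ t : ℝ, 0 ≤ t → t ≤ 1 →
    modular (x + t • h) ≤ modular x + t * modularDeriv x h + t ^ 2 * C := by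
  -- The squares of `h n` need not be summable. Where `|x n| + |h n| ≤ 1` the whole ray stays in the
  -- flat region and no remainder is needed, so only finitely many terms survive.
  set κ : ℕ → ℝ := fun n => if |x n| + |h n| ≤ 1 then 0 else 2 * h n ^ 2 with hκ
  have hκs : Summable κ := by
    refine summable_of_eventually_atTop_eq_zero ?_
    filter_upwards [x.eventually_abs_lt (half_pos one_pos), h.eventually_abs_lt (half_pos one_pos)]
      with n h1 h2
    exact if_pos (by linarith)
  have hκ0 : ∀ n, 0 ≤ κ n := fun n => by simp only [hκ]; split_ifs <;> positivity
  set A := 4 * ‖x‖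
  set B := 4 * ‖h‖
  set K := 6 * A ^ 2 * B ^ 2 + 4 * A * B ^ 3 + B ^ 4 with hK
  have hK0 : 0 ≤ K := by positivity
  have hgs : Summable fun i : ℕ => (1 / 16 : ℝ) ^ i * K :=
    summable_geometric_mul_of_abs_le (c := fun _ => K) fun _ => le_rfl
  refine ⟨∑' n, κ n + ∑' i : ℕ, (1 / 16) ^ i * K,
    add_nonneg (tsum_nonneg hκ0) (tsum_nonneg fun i => by positivity), fun t ht ht1 => ?_⟩
  have e1 := (summable_flatSq (x + t • h)).tsum_le_tsum
    (g := fun n => flatSq (x n) + t * (flatSqDeriv (x n) * h n) + t ^ 2 * κ n) (fun n => by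
      simp only [ZeroAtInftyContinuousMap.add_apply, ZeroAtInftyContinuousMap.smul_apply,
        smul_eq_mul, hκ]
      split_ifs with hn
      · have h1 : |t * h n| ≤ |h n| := by
          rw [abs_mul, abs_of_nonneg ht]; exact mul_le_of_le_one_left (abs_nonneg _) ht1
        have h2 := abs_add_le (x n) (t * h n)
        have h3 := abs_nonneg (h n)
        rw [flatSq_eq_zero (by linarith), flatSq_eq_zero (by linarith),
          flatSqDeriv_eq_zero (by linarith)]
        simp
      · have := flatSq_add_le (x n) (t * h n)
        nlinarith)
    (((summable_flatSq x).add ((summable_flatSqDeriv_mul x h).mul_left t)).add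
      (hκs.mul_left (t ^ 2)))
  have e2 := (summable_testFunctional_pow_four (x + t • h)).tsum_le_tsum
    (g := fun i => (1 / 16) ^ i * testFunctional i x ^ 4 +
      t * (4 * ((1 / 16) ^ i * (testFunctional i x ^ 3 * testFunctional i h))) +
        t ^ 2 * ((1 / 16) ^ i * K)) (fun i => by
      rw [map_add, map_smul, smul_eq_mul]
      have := mul_le_mul_of_nonneg_left (add_mul_pow_four_le (abs_testFunctional_le i x)
        (abs_testFunctional_le i h) ht ht1) (show (0 : ℝ) ≤ (1 / 16) ^ i by positivity)
      refine this.trans (le_of_eq ?_)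
      simp only [hK, A, B]
      ring)
    (((summable_testFunctional_pow_four x).add
      (((summable_testFunctional_pow_three_mul x h).mul_left 4).mul_left t)).add
        (hgs.mul_left (t ^ 2)))
  rw [Summable.tsum_add ((summable_flatSq x).add ((summable_flatSqDeriv_mul x h).mul_left t))
      (hκs.mul_left (t ^ 2)),
    Summable.tsum_add (summable_flatSq x) ((summable_flatSqDeriv_mul x h).mul_left t)] at e1
  rw [Summable.tsum_add ((summable_testFunctional_pow_four x).add
      (((summable_testFunctional_pow_three_mul x h).mul_left 4).mul_left t))
        (hgs.mul_left (t ^ 2)),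
    Summable.tsum_add (summable_testFunctional_pow_four x)
      (((summable_testFunctional_pow_three_mul x h).mul_left 4).mul_left t)] at e2
  rw [tsum_mul_left, tsum_mul_left] at e1
  rw [tsum_mul_left, tsum_mul_left, tsum_mul_left] at e2
  rw [modularDeriv_apply]
  unfold modular
  linarith

theorem norm_le_two_of_modular_le_one {x : C₀(ℕ, ℝ)} (h : modular x ≤ 1) : ‖x‖ ≤ 2 := by
  refine ZeroAtInftyContinuousMap.norm_le_of_forall_abs_le fun n =>
    abs_le_two_of_flatSq_le_one ?_
  have h1 := (summable_flatSq x).le_tsum n fun m _ => flatSq_nonneg (x m)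
  have h2 : 0 ≤ ∑' i, (1 / 16 : ℝ) ^ i * testFunctional i x ^ 4 :=
    tsum_nonneg fun i => by positivity
  unfold modular at h
  linarith

theorem modular_le_one_of_norm_le {x : C₀(ℕ, ℝ)} (h : ‖x‖ ≤ 1 / 8) : modular x ≤ 1 := by
  have h1 : ∑' n, flatSq (x n) = 0 := by
    simp [flatSq_eq_zero ((x.abs_apply_le_norm _).trans (h.trans (by norm_num)))]
  have h2 : ∑' i, (1 / 16 : ℝ) ^ i * testFunctional i x ^ 4 ≤ ∑' i : ℕ, (1 / 2 : ℝ) ^ i * (1 / 2) :=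
    (summable_testFunctional_pow_four x).tsum_le_tsum (fun i => by
      have h3 := (le_abs_self _).trans (abs_testFunctional_pow_le i 4 x)
      have h4 : (4 * ‖x‖) ^ 4 ≤ (1 / 2 : ℝ) ^ 4 := by gcongr; linarith
      gcongr
      · norm_num
      · norm_num at h4 ⊢; linarith) (summable_geometric_two.mul_right _)
  rw [tsum_mul_right, tsum_geometric_two] at h2
  rw [modular, h1]
  linarith

/-- `c • x` is a convex combination of `x` and `-x`, and `modular` is even and convex. -/
theorem modular_smul_le {c : ℝ} (hc : |c| ≤ 1) (x : C₀(ℕ, ℝ)) : modular (c • x) ≤ modular x := by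
  obtain ⟨h1, h2⟩ := abs_le.1 hc
  have := convexOn_modular.2 (Set.mem_univ x) (Set.mem_univ (-x))
    (show 0 ≤ (1 + c) / 2 by linarith) (show 0 ≤ (1 - c) / 2 by linarith) (by ring)
  rw [modular_neg, show ((1 + c) / 2) • x + ((1 - c) / 2) • -x = c • x by module, ← add_smul,
    show (1 + c) / 2 + (1 - c) / 2 = 1 by ring, one_smul] at this
  exact this

end Gauge

/-! ### The equivalent norm defined by the modular -/

section Renorming

theorem absorbent_of_closedBall_subset {E : Type*} [NormedAddCommGroup E] [NormedSpace ℝ E]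
    {B : Set E} {r : ℝ} (hr : 0 < r) (h : ∀ x, ‖x‖ ≤ r → x ∈ B) : Absorbent ℝ B :=
  absorbent_nhds_zero (Filter.mem_of_superset (Metric.closedBall_mem_nhds 0 hr)
    fun x hx => h x (by simpa using hx))

/-- The gauge of a symmetric convex neighbourhood of zero, as a seminorm. -/
noncomputable def unitBallSeminorm {E : Type*} [NormedAddCommGroup E] [NormedSpace ℝ E]
    {B : Set E} {r : ℝ} (hr : 0 < r) (h : ∀ x, ‖x‖ ≤ r → x ∈ B) (hc : Convex ℝ B)
    (hb : ∀ (c : ℝ) (x : E), |c| ≤ 1 → x ∈ B → c • x ∈ B) : Seminorm ℝ E :=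
  gaugeSeminorm (balanced_iff_smul_mem.2 fun {c} hc' x hx => hb c x hc' hx) hc
    (absorbent_of_closedBall_subset hr h)

theorem unitBallSeminorm_le_one {E : Type*} [NormedAddCommGroup E] [NormedSpace ℝ E]
    {B : Set E} {r : ℝ} (hr : 0 < r) (h : ∀ x, ‖x‖ ≤ r → x ∈ B) (hc : Convex ℝ B)
    (hb : ∀ (c : ℝ) (x : E), |c| ≤ 1 → x ∈ B → c • x ∈ B) {x : E} (hx : x ∈ B) :
    unitBallSeminorm hr h hc hb x ≤ 1 :=
  gauge_le_one_of_mem hx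

theorem exists_of_unitBallSeminorm_lt {E : Type*} [NormedAddCommGroup E] [NormedSpace ℝ E]
    {B : Set E} {r : ℝ} (hr : 0 < r) (h : ∀ x, ‖x‖ ≤ r → x ∈ B) (hc : Convex ℝ B)
    (hb : ∀ (c : ℝ) (x : E), |c| ≤ 1 → x ∈ B → c • x ∈ B) {x : E} {a : ℝ}
    (hx : unitBallSeminorm hr h hc hb x < a) : ∃ b, 0 < b ∧ b < a ∧ b⁻¹ • x ∈ B := by
  obtain ⟨b, hb, hba, hx⟩ := exists_lt_of_gauge_lt (absorbent_of_closedBall_subset hr h) hx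
  exact ⟨b, hb, hba, (Set.mem_smul_set_iff_inv_smul_mem₀ hb.ne' _ _).1 hx⟩

/-- The unit ball of the new norm. -/
def modularBall : Set C₀(ℕ, ℝ) := {x | modular x ≤ 1}

theorem convex_modularBall : Convex ℝ modularBall := by
  have := convexOn_modular.convex_le 1
  simpa [modularBall] using this

theorem modularBall_of_norm_le (x : C₀(ℕ, ℝ)) (h : ‖x‖ ≤ 1 / 8) : x ∈ modularBall :=
  modular_le_one_of_norm_le h

theorem smul_mem_modularBall (c : ℝ) (x : C₀(ℕ, ℝ)) (hc : |c| ≤ 1) (hx : x ∈ modularBall) :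
    c • x ∈ modularBall :=
  (modular_smul_le hc x).trans hx

/-- The equivalent norm on `c₀` with unit ball `{modular ≤ 1}`. -/
noncomputable def modularNorm : Seminorm ℝ C₀(ℕ, ℝ) :=
  unitBallSeminorm (r := 1 / 8) (by norm_num) modularBall_of_norm_le convex_modularBall
    smul_mem_modularBall

theorem modularNorm_le_one {x : C₀(ℕ, ℝ)} (h : modular x ≤ 1) : modularNorm x ≤ 1 :=
  unitBallSeminorm_le_one _ modularBall_of_norm_le _ _ h

theorem exists_of_modularNorm_lt {x : C₀(ℕ, ℝ)} {a : ℝ} (h : modularNorm x < a) :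
    ∃ b, 0 < b ∧ b < a ∧ modular (b⁻¹ • x) ≤ 1 :=
  exists_of_unitBallSeminorm_lt _ modularBall_of_norm_le convex_modularBall smul_mem_modularBall h

theorem modularNorm_le (x : C₀(ℕ, ℝ)) : modularNorm x ≤ 8 * ‖x‖ := by
  by_cases hx : x = 0
  · simp [hx]
  have hn : 0 < ‖x‖ := norm_pos_iff.2 hx
  have h1 : modularNorm ((8 * ‖x‖)⁻¹ • x) ≤ 1 := by
    refine modularNorm_le_one (modular_le_one_of_norm_le ?_)
    rw [norm_smul, Real.norm_of_nonneg (by positivity)]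
    field_simp; rfl
  rw [map_smul_eq_mul, Real.norm_of_nonneg (by positivity), inv_mul_le_iff₀ (by positivity)] at h1
  linarith

theorem norm_le_two_mul_modularNorm (x : C₀(ℕ, ℝ)) : ‖x‖ ≤ 2 * modularNorm x := by
  have : ∀ a, modularNorm x < a → ‖x‖ / 2 ≤ a := by
    intro a ha
    obtain ⟨b, hb, hba, hx⟩ := exists_of_modularNorm_lt ha
    have := norm_le_two_of_modular_le_one hx
    rw [norm_smul, Real.norm_of_nonneg (by positivity), inv_mul_le_iff₀ hb] at this
    linarith
  have := le_of_forall_gt_imp_ge_of_dense this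
  linarith

/-- The ray estimate makes `modular` upper semicontinuous radially outwards. A value below `1` would
leave room to enlarge `x` within the ball. For a value above `1`, midpoint convexity between `(1 +
t) • x` and `(1 - t) • x` keeps `modular ((1 - t) • x)` above `1`, although this vector has norm
below `1`. -/
theorem modular_eq_one {x : C₀(ℕ, ℝ)} (h : modularNorm x = 1) : modular x = 1 := by
  obtain ⟨C, hC, hle⟩ := exists_modular_add_smul_le x x
  have hlim : Filter.Tendsto (fun t : ℝ => t * modularDeriv x x + t ^ 2 * C)
      (nhdsWithin 0 (Set.Ioi 0)) (nhds 0) := by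
    have : Continuous fun t : ℝ => t * modularDeriv x x + t ^ 2 * C := by fun_prop
    have := this.tendsto 0
    simp only [zero_mul, ne_eq, OfNat.ofNat_ne_zero, not_false_eq_true, zero_pow, add_zero] at this
    exact this.mono_left nhdsWithin_le_nhds
  have hIoo : Set.Ioo (0 : ℝ) 1 ∈ nhdsWithin (0 : ℝ) (Set.Ioi 0) := Ioo_mem_nhdsGT one_pos
  apply le_antisymm
  · by_contra! hlt
    obtain ⟨t, ht, ht0, ht1⟩ :=
      ((hlim.eventually (gt_mem_nhds (sub_pos.2 hlt))).and hIoo).exists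
    have h1 := hle t ht0.le ht1.le
    have h2 := convexOn_modular.2 (Set.mem_univ (x + t • x)) (Set.mem_univ ((1 - t) • x))
      (show (0 : ℝ) ≤ 1 / 2 by norm_num) (show (0 : ℝ) ≤ 1 / 2 by norm_num) (by norm_num)
    have h3 : (1 / 2 : ℝ) • (x + t • x) + (1 / 2 : ℝ) • ((1 - t) • x) = x := by module
    rw [h3, smul_eq_mul, smul_eq_mul] at h2
    have h4 : 1 < modular ((1 - t) • x) := by linarith
    have h5 : modularNorm x < (1 - t)⁻¹ := by
      rw [h]; exact (one_lt_inv₀ (by linarith)).2 (by linarith)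
    obtain ⟨b, hb, hbt, hx⟩ := exists_of_modularNorm_lt h5
    have h6 : (1 - t) • x = ((1 - t) * b) • b⁻¹ • x := by
      rw [smul_smul, mul_assoc, mul_inv_cancel₀ hb.ne', mul_one]
    have h7 : (1 - t) * b ≤ 1 := by
      rw [mul_comm, ← le_div_iff₀ (by linarith), one_div]; exact hbt.le
    have h8 : 0 ≤ (1 - t) * b := mul_nonneg (by linarith) hb.le
    rw [h6] at h4
    exact absurd (h4.trans_le (modular_smul_le (by rwa [abs_of_nonneg h8]) _)) (not_lt.2 hx)
  · by_contra! hlt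
    obtain ⟨t, ht, ht0, ht1⟩ :=
      ((hlim.eventually (gt_mem_nhds (sub_pos.2 hlt))).and hIoo).exists
    have h1 := modularNorm_le_one (x := x + t • x) (by linarith [hle t ht0.le ht1.le])
    rw [show x + t • x = (1 + t) • x by module, map_smul_eq_mul, h,
      Real.norm_of_nonneg (by linarith)] at h1
    linarith

/-- `c₀` with the norm `modularNorm`. -/
def RenormedC0 : Type := C₀(ℕ, ℝ)

namespace RenormedC0

noncomputable instance : AddCommGroup RenormedC0 := inferInstanceAs (AddCommGroup C₀(ℕ, ℝ))

noncomputable instance : Module ℝ RenormedC0 := inferInstanceAs (Module ℝ C₀(ℕ, ℝ))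

noncomputable instance : Norm RenormedC0 := ⟨fun x => modularNorm x⟩

theorem core : NormedSpace.Core ℝ RenormedC0 where
  norm_nonneg x := apply_nonneg modularNorm x
  norm_smul c x := map_smul_eq_mul modularNorm c x
  norm_triangle x y := map_add_le_add modularNorm x y
  norm_eq_zero_iff x := by
    constructor
    · intro h
      have h1 := norm_le_two_mul_modularNorm x
      rw [show modularNorm x = 0 from h, mul_zero] at h1
      exact norm_le_zero_iff.1 h1
    · rintro rfl
      exact map_zero modularNorm

noncomputable instance : NormedAddCommGroup RenormedC0 := NormedAddCommGroup.ofCore core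

noncomputable instance : NormedSpace ℝ RenormedC0 := NormedSpace.ofCore core

/-- The new norm is equivalent to the old one. -/
noncomputable def equivC0 : RenormedC0 ≃L[ℝ] C₀(ℕ, ℝ) :=
  LinearEquiv.toContinuousLinearEquivOfBounds
    (LinearEquiv.refl ℝ C₀(ℕ, ℝ) : RenormedC0 ≃ₗ[ℝ] C₀(ℕ, ℝ)) 2 8
    norm_le_two_mul_modularNorm modularNorm_le

instance : CompleteSpace RenormedC0 :=
  (completeSpace_congr (e := equivC0.toEquiv) equivC0.isUniformEmbedding).2 inferInstance

end RenormedC0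

end Renorming

/-! ### Rigidity of the derivatives -/

section Rigidity

/-- The Hankel matrix with rows `(c0, c1, c2)` and `(c1, c2, c3)` attached to a binary cubic has
rank at most one for a cube, but rank two for a combination of cubes of two independent forms with
nonzero coefficients. -/
theorem cross_eq_of_cubes_add {α β X X' Y Y' Z Z' : ℝ} (hα : 0 < α) (hβ : 0 < β)
    (h : ∀ a b : ℝ, (a = 1 ∧ b = 1 / 2) ∨ (a = 1 / 2 ∧ b = 1) ∨ (a = 3 / 2 ∧ b = 0) ∨
      (a = 0 ∧ b = 3 / 2) → α * (a * X + b * X') ^ 3 + β * (a * Y + b * Y') ^ 3 =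
        (a * Z + b * Z') ^ 3) : X * Y' = Y * X' := by
  have e1 := h 1 (1 / 2) (by norm_num)
  have e2 := h (1 / 2) 1 (by norm_num)
  have e3 := h (3 / 2) 0 (by norm_num)
  have e4 := h 0 (3 / 2) (by norm_num)
  -- The four points lie in distinct directions, so they determine the four coefficients of the
  -- cubic.
  have c0 : α * X ^ 3 + β * Y ^ 3 = Z ^ 3 := by linear_combination 8 / 27 * e3
  have c3 : α * X' ^ 3 + β * Y' ^ 3 = Z' ^ 3 := by linear_combination 8 / 27 * e4
  have c1 : α * (X ^ 2 * X') + β * (Y ^ 2 * Y') = Z ^ 2 * Z' := by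
    linear_combination 4 / 9 * (2 * e1 - e2 - 15 / 8 * c0 + 3 / 4 * c3)
  have c2 : α * (X * X' ^ 2) + β * (Y * Y' ^ 2) = Z * Z' ^ 2 := by
    linear_combination 4 / 9 * (2 * e2 - e1 - 15 / 8 * c3 + 3 / 4 * c0)
  by_contra hne
  set D := X * Y' - Y * X' with hD
  have hD0 : D ≠ 0 := sub_ne_zero.2 hne
  have hc : α * β * D ^ 2 ≠ 0 := by positivity
  -- The minors are `α β D²` times `X Y`, `X' Y'` and `X Y' + Y X'`. If these three factors vanish,
  -- so does `D² = (X Y' + Y X')² - 4 X Y X' Y'`.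
  have d1 : X * Y = 0 := by
    refine (mul_eq_zero.1 (?_ : (α * β * D ^ 2) * (X * Y) = 0)).resolve_left hc
    have : (α * X ^ 3 + β * Y ^ 3) * (α * (X * X' ^ 2) + β * (Y * Y' ^ 2)) -
        (α * (X ^ 2 * X') + β * (Y ^ 2 * Y')) ^ 2 = 0 := by rw [c0, c1, c2]; ring
    rw [← this, hD]; ring
  have d2 : X' * Y' = 0 := by
    refine (mul_eq_zero.1 (?_ : (α * β * D ^ 2) * (X' * Y') = 0)).resolve_left hc
    have : (α * X' ^ 3 + β * Y' ^ 3) * (α * (X ^ 2 * X') + β * (Y ^ 2 * Y')) -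
        (α * (X * X' ^ 2) + β * (Y * Y' ^ 2)) ^ 2 = 0 := by rw [c3, c1, c2]; ring
    rw [← this, hD]; ring
  have d3 : X * Y' + Y * X' = 0 := by
    refine (mul_eq_zero.1 (?_ : (α * β * D ^ 2) * (X * Y' + Y * X') = 0)).resolve_left hc
    have : (α * X ^ 3 + β * Y ^ 3) * (α * X' ^ 3 + β * Y' ^ 3) -
        (α * (X ^ 2 * X') + β * (Y ^ 2 * Y')) * (α * (X * X' ^ 2) + β * (Y * Y' ^ 2)) = 0 := by
      rw [c0, c1, c2, c3]; ring
    rw [← this, hD]; ring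
  refine hD0 (pow_eq_zero_iff two_ne_zero |>.1 ?_)
  rw [hD]
  linear_combination (X * Y' + Y * X') * d3 - 4 * X' * Y' * d1

/-- Far unit vectors detect only the quartic part, which forces the cubic identity for each test
functional, and then at each limit `eₚ + e_q / 2`. The weight `1 / 2` makes `(m, n)` and `(n, m)`
give different directions; `(m, m)` and `(n, n)` supply the other two. -/
theorem cross_eq_of_modularDeriv_combination {α β : ℝ} (hα : 0 < α) (hβ : 0 < β)
    {x y z : C₀(ℕ, ℝ)}
    (h : ∀ v, α * modularDeriv x v + β * modularDeriv y v = modularDeriv z v) (m n : ℕ) :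
    x m * y n = y m * x n := by
  set c : ℕ → ℝ := fun i => α * testFunctional i x ^ 3 + β * testFunctional i y ^ 3 -
    testFunctional i z ^ 3 with hc
  have hbound : ∀ i, |c i| ≤ α * (4 * ‖x‖) ^ 3 + β * (4 * ‖y‖) ^ 3 + (4 * ‖z‖) ^ 3 := by
    intro i
    have h1 := mul_le_mul_of_nonneg_left (abs_testFunctional_pow_le i 3 x) hα.le
    have h2 := mul_le_mul_of_nonneg_left (abs_testFunctional_pow_le i 3 y) hβ.le
    have h3 := abs_testFunctional_pow_le i 3 z
    refine (abs_sub _ _).trans (add_le_add ((abs_add_le _ _).trans (add_le_add ?_ ?_)) h3)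
    · rwa [abs_mul, abs_of_pos hα]
    · rwa [abs_mul, abs_of_pos hβ]
  have hflat : ∀ w : C₀(ℕ, ℝ), ∀ᶠ k in Filter.atTop, modularDeriv w (unitVec k) =
      4 * ∑' i, (1 / 16) ^ i * (testFunctional i w ^ 3 * testFunctional i (unitVec k)) := by
    intro w
    filter_upwards [eventually_flatSqDeriv_eq_zero w] with k hk
    rw [modularDeriv_apply, tsum_eq_single k fun j hj => by simp [unitVec_apply, hj], hk, zero_mul,
      zero_add]
  have hzero : ∀ i, c i = 0 := by
    refine eq_zero_of_tsum_testFunctional_eventually_eq_zero hbound ?_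
    filter_upwards [hflat x, hflat y, hflat z] with k h1 h2 h3
    have hk := h (unitVec k)
    rw [h1, h2, h3] at hk
    have hs := (((summable_testFunctional_pow_three_mul x (unitVec k)).hasSum.mul_left α).add
      ((summable_testFunctional_pow_three_mul y (unitVec k)).hasSum.mul_left β)).sub
        (summable_testFunctional_pow_three_mul z (unitVec k)).hasSum
    refine Eq.trans (tsum_congr fun i => ?_) (hs.tsum_eq.trans (by linarith))
    simp only [hc]
    ring
  have hlim : ∀ p q : ℕ, α * (x p + 1 / 2 * x q) ^ 3 + β * (y p + 1 / 2 * y q) ^ 3 =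
      (z p + 1 / 2 * z q) ^ 3 := by
    intro p q
    have ht := ((((tendsto_testFunctional p q x).pow 3).const_mul α).add
      (((tendsto_testFunctional p q y).pow 3).const_mul β)).sub ((tendsto_testFunctional p q z).pow 3)
    exact sub_eq_zero.1 (tendsto_nhds_unique ht
      (tendsto_const_nhds.congr fun k => (hzero (Nat.pair (Nat.pair p q) k)).symm))
  refine cross_eq_of_cubes_add (Z := z m) (Z' := z n) hα hβ ?_
  rintro a b (⟨rfl, rfl⟩ | ⟨rfl, rfl⟩ | ⟨rfl, rfl⟩ | ⟨rfl, rfl⟩)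
  · linear_combination hlim m n
  · linear_combination hlim n m
  · linear_combination hlim m m
  · linear_combination hlim n n

end Rigidity

/-! ### Norm-attaining functionals of the renormed space -/

namespace RenormedC0

theorem modularDeriv_self_pos {x : C₀(ℕ, ℝ)} (hx : modularNorm x = 1) : 0 < modularDeriv x x := by
  linarith [modular_le_modularDeriv_self x, modular_eq_one hx]

/-- A direction of strict descent points into the ball, where `f` cannot exceed its value at `x`. -/
theorem apply_nonpos_of_modularDeriv_neg {f : StrongDual ℝ RenormedC0} {x h : RenormedC0}
    (hx : ‖x‖ = 1) (hf : f x = ‖f‖) (hh : modularDeriv x h < 0) : f h ≤ 0 := by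
  obtain ⟨C, hC, hle⟩ := exists_modular_add_smul_le x h
  -- This step is short enough for the linear decrease to dominate `t² C`; `C + 1` avoids division
  -- by zero.
  set t : ℝ := min 1 (-modularDeriv x h / (C + 1)) with ht
  have ht0 : 0 < t := lt_min one_pos (div_pos (neg_pos.2 hh) (by linarith))
  have ht1 : t * (C + 1) ≤ -modularDeriv x h := by
    rw [← le_div_iff₀ (by linarith)]; exact min_le_right _ _
  have h1 := hle t ht0.le (min_le_left _ _)
  have h2 : t * (t * (C + 1)) ≤ t * -modularDeriv x h := mul_le_mul_of_nonneg_left ht1 ht0.le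
  have h3 : ‖x + t • h‖ ≤ 1 := modularNorm_le_one (by
    have := modular_eq_one hx
    refine h1.trans ?_
    nlinarith)
  have h4 : f (x + t • h) ≤ ‖f‖ := by
    have := (le_abs_self _).trans (f.le_opNorm (x + t • h))
    nlinarith [norm_nonneg f]
  rw [map_add, map_smul, smul_eq_mul, hf] at h4
  by_contra! hpos
  nlinarith [mul_pos ht0 hpos]

theorem apply_nonpos_of_modularDeriv_eq_zero {f : StrongDual ℝ RenormedC0} {x h : RenormedC0}
    (hx : ‖x‖ = 1) (hf : f x = ‖f‖) (hh : modularDeriv x h = 0) : f h ≤ 0 := by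
  have hpos : 0 < modularDeriv x x := modularDeriv_self_pos hx
  refine le_of_forall_pos_le_add fun ε hε => ?_
  have hf0 : 0 ≤ f x := hf ▸ norm_nonneg f
  -- Tilting `h` slightly towards `-x` gives strict descent, at a cost of at most `ε` in the value
  -- of `f`.
  have h1 : f (h - (ε / (f x + 1)) • x) ≤ 0 := by
    refine apply_nonpos_of_modularDeriv_neg hx hf ?_
    have : modularDeriv x (h - (ε / (f x + 1)) • x) =
        modularDeriv x h - ε / (f x + 1) * modularDeriv x x := by
      refine (map_sub (modularDeriv x) _ _).trans ?_
      exact congrArg _ (map_smul (modularDeriv x) _ _)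
    rw [this, hh, zero_sub, neg_lt_zero]
    positivity
  rw [map_sub, map_smul, smul_eq_mul] at h1
  have h2 : ε / (f x + 1) * f x ≤ ε := by
    rw [div_mul_eq_mul_div, div_le_iff₀ (by linarith)]
    nlinarith
  linarith

/-- A functional attaining its norm at `x` is a multiple of the derivative at `x`. -/
theorem apply_eq_div_mul_modularDeriv {f : StrongDual ℝ RenormedC0} {x : RenormedC0}
    (hx : ‖x‖ = 1) (hf : f x = ‖f‖) (h : RenormedC0) :
    f h = f x / modularDeriv x x * modularDeriv x h := by
  have hpos : 0 < modularDeriv x x := modularDeriv_self_pos hx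
  -- `k` is a multiple of the projection of `h` along `x` onto the kernel of the derivative; both
  -- `k` and `-k` are tangent, so `f` vanishes there.
  set k : RenormedC0 := modularDeriv x x • h - modularDeriv x h • x with hk
  have hk0 : modularDeriv x k = 0 := by
    have : modularDeriv x k =
        modularDeriv x x * modularDeriv x h - modularDeriv x h * modularDeriv x x := by
      refine (map_sub (modularDeriv x) _ _).trans ?_
      exact congrArg₂ _ (map_smul (modularDeriv x) _ _) (map_smul (modularDeriv x) _ _)
    rw [this]; ring
  have hk0' : modularDeriv x (-k) = 0 := by
    refine (map_neg (modularDeriv x) _).trans ?_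
    rw [hk0, neg_zero]
  have h1 := apply_nonpos_of_modularDeriv_eq_zero hx hf hk0
  have h2 := apply_nonpos_of_modularDeriv_eq_zero hx hf hk0'
  rw [map_neg] at h2
  have h3 : f k = 0 := by linarith
  rw [hk, map_sub, map_smul, map_smul, smul_eq_mul, smul_eq_mul] at h3
  field_simp
  linarith

theorem isSmoothSpace : IsSmoothSpace RenormedC0 := by
  intro x hx
  obtain ⟨g, hg, hgx⟩ := exists_dual_vector ℝ x (by rw [hx]; exact one_ne_zero)
  refine ⟨g, ⟨hg, by simpa [hx] using hgx⟩, ?_⟩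
  rintro f ⟨hf, hfx⟩
  have hgx' : g x = 1 := by simpa [hx] using hgx
  ext h
  rw [apply_eq_div_mul_modularDeriv hx (hfx.trans hf.symm) h,
    apply_eq_div_mul_modularDeriv hx (hgx'.trans hg.symm) h, hfx, hgx']

theorem exists_modularDeriv_of_mem_normAttaining {f : StrongDual ℝ RenormedC0}
    (hf : f ∈ normAttaining RenormedC0) (hf0 : f ≠ 0) :
    ∃ x : RenormedC0, ‖x‖ = 1 ∧ ∃ c : ℝ, 0 < c ∧ ∀ h, f h = c * modularDeriv x h := by
  have key : ∀ x : RenormedC0, ‖x‖ = 1 → f x = ‖f‖ →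
      ∃ x : RenormedC0, ‖x‖ = 1 ∧ ∃ c : ℝ, 0 < c ∧ ∀ h, f h = c * modularDeriv x h :=
    fun x hx hfx => ⟨x, hx, f x / modularDeriv x x,
      div_pos (hfx ▸ norm_pos_iff.2 hf0) (modularDeriv_self_pos hx),
      apply_eq_div_mul_modularDeriv hx hfx⟩
  obtain ⟨x, hx, hfx⟩ := hf
  rcases abs_choice (f x) with h | h
  · exact key x hx (by rw [hfx, h])
  · exact key (-x) (by rw [norm_neg, hx]) (by rw [hfx, h, map_neg])

theorem segmentProperty : SegmentProperty RenormedC0 := by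
  rintro f hf g hg hfg _ ⟨a, b, ha, hb, -, rfl⟩ hh
  have hpair := LinearIndependent.pair_iff.1 hfg
  have hh0 : a • f + b • g ≠ 0 := fun h0 => ha.ne' (hpair a b h0).1
  obtain ⟨x, hx, p, hp, hfx⟩ := exists_modularDeriv_of_mem_normAttaining hf (hfg.ne_zero 0)
  obtain ⟨y, hy, q, hq, hgy⟩ := exists_modularDeriv_of_mem_normAttaining hg (hfg.ne_zero 1)
  obtain ⟨z, hz, r, hr, hhz⟩ := exists_modularDeriv_of_mem_normAttaining hh hh0
  have hcross := cross_eq_of_modularDeriv_combination (x := x) (y := y) (z := z)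
    (show 0 < a * p / r by positivity) (show 0 < b * q / r by positivity) fun v => by
      have h1 : a * f v + b * g v = r * modularDeriv z v := hhz v
      rw [hfx v, hgy v] at h1
      field_simp
      linarith
  have hx0 : ∃ m, equivC0 x m ≠ 0 := by
    by_contra! h0
    have : x = 0 := equivC0.injective (ZeroAtInftyContinuousMap.ext fun n => by
      rw [h0, map_zero, ZeroAtInftyContinuousMap.zero_apply])
    rw [this, norm_zero] at hx
    exact zero_ne_one hx
  obtain ⟨m, hm⟩ := hx0
  -- The vanishing `2 × 2` minors make `y` a multiple of `x`, and unit norms force the factor to be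
  -- `±1`. As the derivative is odd, either sign contradicts independence.
  set s : ℝ := equivC0 y m / equivC0 x m with hs
  have hyx : y = s • x := by
    refine equivC0.injective (ZeroAtInftyContinuousMap.ext fun n => ?_)
    rw [map_smul, ZeroAtInftyContinuousMap.smul_apply, smul_eq_mul, hs, div_mul_eq_mul_div,
      eq_div_iff hm]
    have : equivC0 x m * equivC0 y n = equivC0 y m * equivC0 x n := hcross m n
    linarith
  have hs1 : |s| = 1 := by
    rw [hyx, norm_smul, hx, mul_one] at hy; exact hy
  rcases (abs_eq zero_le_one).1 hs1 with h1 | h1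
  · refine hq.ne' (hpair q (-p) ?_).1
    ext v
    rw [h1, one_smul] at hyx
    change q * f v + -p * g v = 0
    rw [hfx v, hgy v, hyx]; ring
  · refine hq.ne' (hpair q p ?_).1
    ext v
    have hD : modularDeriv y v = -modularDeriv x v := by
      rw [h1, neg_one_smul] at hyx
      rw [hyx]
      exact congrArg (fun L => L v) (modularDeriv_neg x)
    change q * f v + p * g v = 0
    rw [hfx v, hgy v, hD]; ring

end RenormedC0

theorem theorem1 :
    -- the reformulations are valid in every real Banach space
    (∀ (E : Type*) [NormedAddCommGroup E] [NormedSpace ℝ E] [CompleteSpace E],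
      (∀ Z : Submodule ℝ (StrongDual ℝ E), Module.finrank ℝ Z = 2 →
        (SubsetTwoLines ((Z : Set (StrongDual ℝ E)) ∩ normAttaining E) ↔
          ((Z : Set (StrongDual ℝ E)) ∩ Metric.sphere 0 1 ∩ normAttaining E).encard ≤ 4)) ∧
      (TwoLinesProperty E ↔ SegmentProperty E)) ∧
    -- the example
    ∃ (X : Type) (_ : NormedAddCommGroup X) (_ : NormedSpace ℝ X),
      CompleteSpace X ∧
      -- the norm of `X` is an equivalent norm on `c₀`
      Nonempty (X ≃L[ℝ] C₀(ℕ, ℝ)) ∧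
      IsSmoothSpace X ∧
      TwoLinesProperty X ∧
      (∀ Z : Submodule ℝ (StrongDual ℝ X), Module.finrank ℝ Z = 2 →
        ((Z : Set (StrongDual ℝ X)) ∩ Metric.sphere 0 1 ∩ normAttaining X).encard ≤ 4) ∧
      SegmentProperty X ∧
      -- a convex cone of norm-attaining functionals has no two linearly independent elements
      (∀ C : ConvexCone ℝ (StrongDual ℝ X), (C : Set (StrongDual ℝ X)) ⊆ normAttaining X →
        ∀ f ∈ C, ∀ g ∈ C, ¬ LinearIndependent ℝ ![f, g]) := by
  have hseg := RenormedC0.segmentProperty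
  have htwo := twoLinesProperty_of_segmentProperty hseg
  refine ⟨fun E _ _ _ => ⟨fun Z hZ => subsetTwoLines_iff_encard_le hZ,
    segmentProperty_of_twoLinesProperty, twoLinesProperty_of_segmentProperty⟩,
    RenormedC0, inferInstance, inferInstance, inferInstance, ⟨RenormedC0.equivC0⟩,
    RenormedC0.isSmoothSpace, htwo,
    fun Z hZ => (subsetTwoLines_iff_encard_le hZ).1 (htwo Z hZ), hseg,
    fun C hC f hf g hg => not_linearIndependent_of_convexCone hseg hC hf hg⟩
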